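/- Let $n\ge 1$ and equip $\mathbb R^{n+1}$ with the form $\langle x,y\rangle=-x^0y^0+x^1y^1+\cdots+x^ny^n$. Let $X=H^n_{\mathbb R}$ be real hyperbolic space, the set of points of $\mathbb{RP}^n$ represented by vectors $x$ with $\langle x,x\rangle<0$, with the geodesic distance $d(x,y)\ge 0$ given by $\cosh d(x,y)=|\langle x,y\rangle|/(\langle x,x\rangle\langle y,y\rangle)^{1/2}$, on which $G=O(1,n)$ acts. Let $H_0\subset X$ be the half-space of points whose last coordinate is positive (homogeneous coordinates being normalized by $x^0>0$), let $\mathfrak H=\{gH_0: g\in G\}$ be the space of half-spaces, with the topology of the homogeneous space $G/G(H_0)$, where $G(H_0)$ is the stabilizer of $H_0$, and for $x\in X$ let $\Sigma_x\subset\mathfrak H$ be the set of half-spaces containing $x$. There is a nonzero $G$-invariant Radon measure on $\mathfrak H$. For every such measure $\mu_{\mathfrak H}$, each $\Sigma_x$ is a Borel set, and there is a constant $k>0$ such that for all $x,y\in X$ $$\mu_{\mathfrak H}(\Sigma_x\,\triangle\,\Sigma_y)<\infty,\qquad d(x,y)=k\,\mu_{\mathfrak H}(\Sigma_x\,\triangle\,\Sigma_y).$$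 Moreover, for every base point $x_0\in X$ the functions $v_x=\chi_{\Sigma_x}-\chi_{\Sigma_{x_0}}$ belong to $L^2(\mathfrak H,\mu_{\mathfrak H})$ and $\sqrt{d(x,y)}=\|\sqrt k\,v_x-\sqrt k\,v_y\|_2$ for all $x,y\in X$, so that $\sqrt d$ is a Hilbert space distance. Hence $d$ is a measure definite kernel (there are a measure space $(\Omega,\nu)$ and measurable sets $S_x\subset\Omega$, $x\in X$, with $d(x,y)=\nu(S_x\triangle S_y)<\infty$ for all $x,y\in X$) and a kernel of negative type: $d$ is symmetric, vanishes on the diagonal, and $\sum_{i,j=1}^m t_it_j\,d(x_i,x_j)\le 0$ for all $x_1,\dots,x_m\in X$ and all real $t_1,\dots,t_m$ with $\sum_i t_i=0$. -/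

import Mathlib

open MeasureTheory
open scoped LinearAlgebra.Projectivization ENNReal

namespace RealHyperbolic

/-- The form `⟨x, y⟩ = -x⁰y⁰ + x¹y¹ + ⋯ + xⁿyⁿ` on `ℝⁿ⁺¹`. -/
def form {n : ℕ} (x y : Fin (n + 1) → ℝ) : ℝ :=
  -(x 0 * y 0) + ∑ i : Fin n, x i.succ * y i.succ

theorem form_smul_smul {n : ℕ} (a b : ℝ) (x y : Fin (n + 1) → ℝ) :
    form (a • x) (b • y) = a * b * form x y := by
  simp only [form, Pi.smul_apply, smul_eq_mul, mul_add, Finset.mul_sum]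
  congr 1
  · ring
  · exact Finset.sum_congr rfl fun i _ => by ring

/-- Real hyperbolic space: the points of `ℝPⁿ` represented by negative vectors
(by `form_smul_smul` the choice of representative is irrelevant). -/
def Space (n : ℕ) : Type :=
  {p : ℙ ℝ (Fin (n + 1) → ℝ) // form p.rep p.rep < 0}

/-- A representative in `ℝⁿ⁺¹` of a point of hyperbolic space. -/
noncomputable def Space.rep {n : ℕ} (p : Space n) : Fin (n + 1) → ℝ :=
  Projectivization.rep p.1

/-- The geodesic distance, `cosh d(x, y) = |⟨x, y⟩| / (⟨x, x⟩⟨y, y⟩)^(1/2)`, `d(x, y) ≥ 0`. -/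
noncomputable def gdist {n : ℕ} (x y : Space n) : ℝ :=
  Real.arcosh (|form x.rep y.rep| / √(form x.rep x.rep * form y.rep y.rep))

/-- The group `O(1, n)` of invertible matrices preserving the form, with the topology of
`GL(n+1, ℝ)`. -/
def O1 (n : ℕ) : Subgroup (GL (Fin (n + 1)) ℝ) where
  carrier := {g | ∀ x y : Fin (n + 1) → ℝ,
    form (g.1.mulVec x) (g.1.mulVec y) = form x y}
  one_mem' := fun x y => by simp
  mul_mem' := fun {g h} hg hh x y => by
    have := hg (h.1.mulVec x) (h.1.mulVec y)
    rw [Matrix.mulVec_mulVec, Matrix.mulVec_mulVec] at this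
    rw [Units.val_mul, this]
    exact hh x y
  inv_mem' := fun {g} hg x y => by
    have := hg ((g⁻¹).1.mulVec x) ((g⁻¹).1.mulVec y)
    rw [Matrix.mulVec_mulVec, Matrix.mulVec_mulVec, Units.mul_inv, Matrix.one_mulVec,
      Matrix.one_mulVec] at this
    exact this.symm

theorem form_rep_smul_neg {n : ℕ} (g : O1 n) (p : ℙ ℝ (Fin (n + 1) → ℝ))
    (hp : form p.rep p.rep < 0) :
    form (Matrix.GeneralLinearGroup.toLin g.1 • p).rep
      (Matrix.GeneralLinearGroup.toLin g.1 • p).rep < 0 := by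
  have h1 : Matrix.GeneralLinearGroup.toLin g.1 • p =
      Projectivization.mk ℝ (Matrix.GeneralLinearGroup.toLin g.1 • p.rep)
        ((smul_ne_zero_iff_ne _).mpr p.rep_nonzero) := by
    conv_lhs => rw [← p.mk_rep, Projectivization.smul_mk]
  obtain ⟨a, ha⟩ := Projectivization.exists_smul_eq_mk_rep ℝ
    (Matrix.GeneralLinearGroup.toLin g.1 • p.rep)
    ((smul_ne_zero_iff_ne _).mpr p.rep_nonzero)
  have h2 : Matrix.GeneralLinearGroup.toLin g.1 • p.rep = g.1.1.mulVec p.rep := rfl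
  rw [h1, ← ha, Units.smul_def, form_smul_smul, h2, g.2]
  have : (a : ℝ) ≠ 0 := a.ne_zero
  have := mul_self_pos.mpr this
  exact mul_neg_of_pos_of_neg this hp

/-- `O(1, n)` acts on hyperbolic space through its linear action on `ℝⁿ⁺¹`. -/
noncomputable instance instMulActionSpace (n : ℕ) : MulAction (O1 n) (Space n) where
  smul g p := ⟨Matrix.GeneralLinearGroup.toLin g.1 • p.1, form_rep_smul_neg g p.1 p.2⟩
  one_smul p := Subtype.ext <| by
    change Matrix.GeneralLinearGroup.toLin (1 : O1 n).1 • p.1 = p.1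
    rw [OneMemClass.coe_one, map_one, one_smul]
  mul_smul g h p := Subtype.ext <| by
    change Matrix.GeneralLinearGroup.toLin (g * h).1 • p.1 =
      Matrix.GeneralLinearGroup.toLin g.1 • Matrix.GeneralLinearGroup.toLin h.1 • p.1
    rw [Subgroup.coe_mul, map_mul, mul_smul]

/-- The action of `O(1, n)` on sets of points, `g • A = {g • p | p ∈ A}`. -/
noncomputable instance instMulActionSet (n : ℕ) : MulAction (O1 n) (Set (Space n)) :=
  Set.mulActionSet

/-- The half-space `H₀` of points whose last coordinate is positive, homogeneous coordinates
being normalized by `x⁰ > 0`. -/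
def stdHalfSpace (n : ℕ) : Set (Space n) :=
  {p | 0 < p.rep 0 * p.rep (Fin.last n)}

/-- The space of half-spaces: the `O(1, n)`-translates of `H₀`. -/
def HalfSpace (n : ℕ) : Type :=
  MulAction.orbit (O1 n) (stdHalfSpace n)

noncomputable instance (n : ℕ) : MulAction (O1 n) (HalfSpace n) :=
  inferInstanceAs (MulAction (O1 n) (MulAction.orbit (O1 n) (stdHalfSpace n)))

/-- The half-space `g • H₀`. -/
noncomputable def HalfSpace.ofGroup {n : ℕ} (g : O1 n) : HalfSpace n :=
  ⟨g • stdHalfSpace n, g, rfl⟩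

/-- The topology of the homogeneous space `G / G(H₀)`, where `G = O(1, n)` and `G(H₀)` is the
stabilizer of `H₀`: the quotient topology for `g ↦ g • H₀`. -/
noncomputable instance (n : ℕ) : TopologicalSpace (HalfSpace n) :=
  TopologicalSpace.coinduced HalfSpace.ofGroup inferInstance

noncomputable instance (n : ℕ) : MeasurableSpace (HalfSpace n) := borel (HalfSpace n)

instance (n : ℕ) : BorelSpace (HalfSpace n) := ⟨rfl⟩

/-- `Σ_x`, the set of half-spaces containing `x`. -/
def halfSpacesThrough {n : ℕ} (x : Space n) : Set (HalfSpace n) :=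
  {H | x ∈ H.1}

/-- The invariant measures on the space of half-spaces: the nonzero `O(1, n)`-invariant Borel
measures which are finite on compact sets. (The space is locally compact, Hausdorff and second
countable, so these are precisely the nonzero invariant Radon measures.) -/
structure IsInvariantMeasure {n : ℕ} (μ : Measure (HalfSpace n)) : Prop where
  ne_zero : μ ≠ 0
  invariant : SMulInvariantMeasure (O1 n) (HalfSpace n) μ
  finite_on_compacts : IsFiniteMeasureOnCompacts μ

/-- The function `v_x = χ_{Σ_x} - χ_{Σ_{x₀}}` on the space of half-spaces. -/
noncomputable def vfun {n : ℕ} (x₀ x : Space n) (H : HalfSpace n) : ℝ :=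
  (halfSpacesThrough x).indicator (fun _ => (1 : ℝ)) H -
    (halfSpacesThrough x₀).indicator (fun _ => (1 : ℝ)) H

/-- Kernels of negative type. -/
structure IsNegativeType {X : Type*} (d : X → X → ℝ) : Prop where
  diag : ∀ x, d x x = 0
  symm : ∀ x y, d x y = d y x
  sum_nonpos : ∀ (m : ℕ) (x : Fin m → X) (t : Fin m → ℝ), ∑ i, t i = 0 →
    ∑ i, ∑ j, t i * t j * d (x i) (x j) ≤ 0

/-- Measure definite kernels: `d(x, y) = ν(S_x △ S_y)` for some measurable sets `S_x` of some
measure space, all these measures being finite. -/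
def IsMeasureDefinite {X : Type*} (d : X → X → ℝ) : Prop :=
  ∃ (Ω : Type) (_ : MeasurableSpace Ω) (ν : Measure Ω) (S : X → Set Ω),
    (∀ x, MeasurableSet (S x)) ∧
      ∀ x y, ν (symmDiff (S x) (S y)) ≠ ∞ ∧ d x y = (ν (symmDiff (S x) (S y))).toReal

end RealHyperbolic

/-!
The half-spaces of hyperbolic space correspond to their unit normal vectors, that is, to the
points of the quadric `⟨v, v⟩ = 1`: `v` gives the set `posSide v` of points whose future-directed
representatives have positive product with `v`, and `g ∈ O(1, n)` moves it to `posSide (± g v)`,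
the sign telling whether `g` preserves the time orientation. The map `toHalfSpace` from spacelike
vectors to half-spaces is onto, and continuous because a reflection moving the last basis vector,
up to sign, to a given unit vector `v` can locally be chosen to depend continuously on `v`.

*Existence.* `coneMeasure` is the image of Lebesgue measure on the region `0 < ⟨v, v⟩ < 1` under
`toHalfSpace`. It is invariant because elements of `O(1, n)` have determinant `±1`. It is locally
finite because every half-space has a neighbourhood consisting of half-spaces which separate two
given points (`exists_symmDiff_mem_nhds`), and the normal vectors of those are bounded
(`mem_Icc_of_form_geodVec_mul_nonpos`).

*Crofton formula.* Let `μ` be any invariant measure; its uniqueness is not needed. As pairs of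
points are classified by their distance (`exists_smul_eq_geod`), `μ (Σ_x △ Σ_y) = F (d(x, y))` for
a function `F`. It is finite, since `Σ_x △ Σ_y` lies in a compact set. Half-spaces and their
complements are convex, so for three consecutive points of a geodesic `Σ_x △ Σ_z` is the disjoint
union of `Σ_x △ Σ_y` and `Σ_y △ Σ_z` (`symmDiff_geod_eq_union`); hence `F` is additive, and being
nonnegative it is linear. If `F` vanished, `μ` would be locally zero and hence zero.

*Consequences.* `(v_x - v_y)²` is the characteristic function of `Σ_x △ Σ_y`, so that
`‖v_x - v_y‖²` is its measure. A squared Hilbert space distance is of negative type.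
-/

namespace RealHyperbolic

/-! ### The Lorentzian form -/

section Form

variable {n : ℕ}

theorem form_comm (x y : Fin (n + 1) → ℝ) : form x y = form y x := by
  simp only [form, mul_comm]

theorem form_add_right (x y z : Fin (n + 1) → ℝ) : form x (y + z) = form x y + form x z := by
  simp only [form, Pi.add_apply, mul_add, Finset.sum_add_distrib]
  ring

theorem form_smul_right (a : ℝ) (x y : Fin (n + 1) → ℝ) : form x (a • y) = a * form x y := by
  simpa using form_smul_smul 1 a x y

theorem form_smul_left (a : ℝ) (x y : Fin (n + 1) → ℝ) : form (a • x) y = a * form x y := by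
  rw [form_comm, form_smul_right, form_comm]

theorem form_neg_left (x y : Fin (n + 1) → ℝ) : form (-x) y = -form x y := by
  rw [← neg_one_smul ℝ x, form_smul_left, neg_one_mul]

theorem form_sub_right (x y z : Fin (n + 1) → ℝ) : form x (y - z) = form x y - form x z := by
  rw [sub_eq_add_neg, ← neg_one_smul ℝ z, form_add_right, form_smul_right]
  ring

theorem form_sub_left (x y z : Fin (n + 1) → ℝ) : form (x - y) z = form x z - form y z := by
  rw [form_comm, form_sub_right, form_comm z, form_comm z]

theorem form_single_zero (x : Fin (n + 1) → ℝ) : form (Pi.single 0 1) x = -x 0 := by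
  simp [form]

theorem form_single_succ (i : Fin n) (x : Fin (n + 1) → ℝ) :
    form (Pi.single i.succ 1) x = x i.succ := by
  simp [form, Pi.single_apply]

theorem form_self (x : Fin (n + 1) → ℝ) : form x x = -x 0 ^ 2 + ∑ i : Fin n, x i.succ ^ 2 := by
  simp only [form, sq]

@[fun_prop]
theorem continuous_form {X : Type*} [TopologicalSpace X] {f g : X → Fin (n + 1) → ℝ}
    (hf : Continuous f) (hg : Continuous g) : Continuous fun x => form (f x) (g x) := by
  unfold form
  fun_prop

/-- Two timelike vectors point into the same half of the light cone exactly if their product is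
negative. -/
theorem mul_mul_form_neg {x y : Fin (n + 1) → ℝ} (hx : form x x < 0) (hy : form y y < 0) :
    x 0 * y 0 * form x y < 0 := by
  rw [form_self] at hx hy
  have hcs := Finset.sum_mul_sq_le_sq_mul_sq Finset.univ (fun i : Fin n => x i.succ)
    (fun i => y i.succ)
  have hY : 0 ≤ ∑ i : Fin n, y i.succ ^ 2 := Finset.sum_nonneg fun i _ => sq_nonneg _
  have hX : 0 ≤ ∑ i : Fin n, x i.succ ^ 2 := Finset.sum_nonneg fun i _ => sq_nonneg _
  have hlt : (∑ i : Fin n, x i.succ * y i.succ) ^ 2 < (x 0 * y 0) ^ 2 := by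
    rw [mul_pow]
    refine hcs.trans_lt ?_
    exact mul_lt_mul'' (by linarith) (by linarith) hX hY
  unfold form
  have := sq_lt_sq.mp hlt
  have h0 : 0 < |x 0 * y 0| := (abs_nonneg _).trans_lt this
  have h1 : x 0 * y 0 * (∑ i : Fin n, x i.succ * y i.succ) < |x 0 * y 0| * |x 0 * y 0| :=
    (le_abs_self _).trans_lt (by rw [abs_mul]; exact mul_lt_mul_of_pos_left this h0)
  rw [abs_mul_abs_self] at h1
  linarith

theorem apply_zero_ne_zero {x : Fin (n + 1) → ℝ} (hx : form x x < 0) : x 0 ≠ 0 := by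
  intro h
  simpa [h] using mul_mul_form_neg hx hx

end Form

/-! ### Reflections -/

section Reflection

variable {n : ℕ}

/-- The linear form `form w`, as a vector of coefficients. -/
def lower (w : Fin (n + 1) → ℝ) : Fin (n + 1) → ℝ :=
  Fin.cons (-w 0) fun i => w i.succ

theorem lower_dotProduct (w x : Fin (n + 1) → ℝ) : lower w ⬝ᵥ x = form w x := by
  simp [lower, dotProduct, form, Fin.sum_univ_succ]

/-- The matrix of the reflection `x ↦ x - 2 (⟨w, x⟩ / ⟨w, w⟩) w`. -/
noncomputable def reflMatrix (w : Fin (n + 1) → ℝ) : Matrix (Fin (n + 1)) (Fin (n + 1)) ℝ :=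
  1 - (2 / form w w) • Matrix.vecMulVec w (lower w)

theorem reflMatrix_mulVec (w x : Fin (n + 1) → ℝ) :
    (reflMatrix w).mulVec x = x - (2 * form w x / form w w) • w := by
  rw [reflMatrix, Matrix.sub_mulVec, Matrix.one_mulVec, Matrix.smul_mulVec,
    Matrix.vecMulVec_mulVec, lower_dotProduct]
  congr 1
  ext i
  simp
  ring

theorem reflMatrix_mul_self {w : Fin (n + 1) → ℝ} (hw : form w w ≠ 0) :
    reflMatrix w * reflMatrix w = 1 := by
  rw [← Matrix.toLin'.injective.eq_iff]
  refine LinearMap.ext fun x => ?_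
  rw [Matrix.toLin'_apply, ← Matrix.mulVec_mulVec, Matrix.toLin'_one, LinearMap.id_apply,
    reflMatrix_mulVec, reflMatrix_mulVec, form_sub_right, form_smul_right]
  ext i
  simp only [Pi.sub_apply, Pi.smul_apply, smul_eq_mul]
  field_simp
  ring

/-- The reflection in the hyperplane orthogonal to a non-isotropic vector. -/
noncomputable def refl (w : Fin (n + 1) → ℝ) (hw : form w w ≠ 0) : O1 n :=
  ⟨⟨reflMatrix w, reflMatrix w, reflMatrix_mul_self hw, reflMatrix_mul_self hw⟩, fun x y => by
    change form ((reflMatrix w).mulVec x) ((reflMatrix w).mulVec y) = form x y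
    simp only [reflMatrix_mulVec, form_sub_left, form_sub_right, form_smul_left, form_smul_right,
      form_comm x w]
    field_simp
    ring⟩

theorem refl_mulVec (w : Fin (n + 1) → ℝ) (hw : form w w ≠ 0) (x : Fin (n + 1) → ℝ) :
    (refl w hw).1.1.mulVec x = x - (2 * form w x / form w w) • w :=
  reflMatrix_mulVec w x

theorem refl_sub_mulVec {a b : Fin (n + 1) → ℝ} (hab : form a a = form b b)
    (hw : form (a - b) (a - b) ≠ 0) : (refl (a - b) hw).1.1.mulVec a = b := by
  have h : 2 * form (a - b) a = form (a - b) (a - b) := by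
    simp only [form_sub_left, form_sub_right, form_comm b a, hab]
    ring
  rw [refl_mulVec, h, div_self hw, one_smul, sub_sub_cancel]

theorem continuous_refl {X : Type*} [TopologicalSpace X] {f : X → Fin (n + 1) → ℝ}
    (hf : Continuous f) (hw : ∀ x, form (f x) (f x) ≠ 0) :
    Continuous fun x => refl (f x) (hw x) := by
  have hlow : Continuous fun x => lower (f x) := by
    unfold lower
    fun_prop
  have h : Continuous fun x => reflMatrix (f x) := by
    unfold reflMatrix
    have h2 : Continuous fun x => 2 / form (f x) (f x) :=
      continuous_const.div (by fun_prop) hw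
    exact continuous_const.sub (h2.smul (hf.matrix_vecMulVec hlow))
  exact (Units.continuous_iff.mpr ⟨h, h⟩).subtype_mk _

end Reflection

/-! ### Determinants and time orientation -/

section Group

variable {n : ℕ}

theorem det_sq_eq_one (g : O1 n) : g.1.1.det ^ 2 = 1 := by
  let J : Matrix (Fin (n + 1)) (Fin (n + 1)) ℝ := Matrix.diagonal (lower 1)
  have hJ : ∀ x y, x ⬝ᵥ J.mulVec y = form x y := fun x y => by
    simp [J, Matrix.mulVec_diagonal, dotProduct, Fin.sum_univ_succ, lower, form]
  have hdet : J.det ≠ 0 := by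
    simp [J, Matrix.det_diagonal, Fin.prod_univ_succ, lower]
  have h : g.1.1.transpose * J * g.1.1 = J := by
    refine Matrix.ext_of_mulVec_single fun i => ?_
    ext j
    have h1 := g.2 (Pi.single j 1) (Pi.single i 1)
    rw [← hJ, ← hJ, Matrix.mulVec_mulVec, ← Matrix.vecMul_transpose, ← Matrix.dotProduct_mulVec,
      Matrix.mulVec_mulVec, single_one_dotProduct, single_one_dotProduct] at h1
    rw [Matrix.mul_assoc]
    exact h1
  have h2 := congrArg Matrix.det h
  rw [Matrix.det_mul, Matrix.det_mul, Matrix.det_transpose] at h2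
  have : (g.1.1.det ^ 2 - 1) * J.det = 0 := by linear_combination h2
  rcases mul_eq_zero.mp this with h | h
  · linarith
  · exact absurd h hdet

/-- Multiplication by `g` preserves or reverses the time orientation of all timelike vectors
simultaneously, according to the sign of the entry `g₀₀`. -/
theorem mulVec_zero_mul_pos (g : O1 n) {w : Fin (n + 1) → ℝ} (hw : form w w < 0) :
    0 < g.1.1 0 0 * (g.1.1.mulVec w 0 * w 0) := by
  have he : form (Pi.single 0 1 : Fin (n + 1) → ℝ) (Pi.single 0 1) < 0 := by
    rw [form_single_zero]; simp
  have hge : form (g.1.1.mulVec (Pi.single 0 1)) (g.1.1.mulVec (Pi.single 0 1)) < 0 := by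
    rwa [g.2]
  have hgw : form (g.1.1.mulVec w) (g.1.1.mulVec w) < 0 := by rwa [g.2]
  have h := mul_mul_form_neg hge hgw
  rw [g.2, form_single_zero] at h
  have h0 : g.1.1.mulVec (Pi.single 0 1) 0 = g.1.1 0 0 := by simp
  rw [h0] at h
  linarith

theorem apply_zero_zero_ne_zero (g : O1 n) : g.1.1 0 0 ≠ 0 := by
  have he : form (Pi.single 0 1 : Fin (n + 1) → ℝ) (Pi.single 0 1) < 0 := by
    rw [form_single_zero]; simp
  exact left_ne_zero_of_mul (mulVec_zero_mul_pos g he).ne'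

end Group

/-! ### Points and half-spaces in terms of vectors -/

section Points

variable {n : ℕ}

theorem ne_zero_of_form_neg {v : Fin (n + 1) → ℝ} (hv : form v v < 0) : v ≠ 0 := by
  rintro rfl
  simp [form] at hv

theorem exists_mk_rep_eq (v : Fin (n + 1) → ℝ) (hv : v ≠ 0) :
    ∃ a : ℝ, a ≠ 0 ∧ (Projectivization.mk ℝ v hv).rep = a • v := by
  obtain ⟨a, ha⟩ := Projectivization.exists_smul_eq_mk_rep ℝ v hv
  exact ⟨a, a.ne_zero, by rw [← ha, Units.smul_def]⟩

/-- The point of hyperbolic space represented by a timelike vector. -/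
noncomputable def pt (v : Fin (n + 1) → ℝ) (hv : form v v < 0) : Space n :=
  ⟨Projectivization.mk ℝ v (ne_zero_of_form_neg hv), by
    obtain ⟨a, ha, h⟩ := exists_mk_rep_eq v (ne_zero_of_form_neg hv)
    rw [h, form_smul_smul]
    exact mul_neg_of_pos_of_neg (mul_self_pos.mpr ha) hv⟩

theorem exists_pt_rep_eq (v : Fin (n + 1) → ℝ) (hv : form v v < 0) :
    ∃ a : ℝ, a ≠ 0 ∧ (pt v hv).rep = a • v :=
  exists_mk_rep_eq v (ne_zero_of_form_neg hv)

theorem pt_rep (x : Space n) : pt x.rep x.2 = x :=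
  Subtype.ext x.1.mk_rep

theorem pt_eq_pt {v w : Fin (n + 1) → ℝ} (hv : form v v < 0) (hw : form w w < 0) {a : ℝ}
    (h : a • w = v) : pt v hv = pt w hw :=
  Subtype.ext <| (Projectivization.mk_eq_mk_iff' ℝ v w _ _).mpr ⟨a, h⟩

/-- The hyperboloid model: every point is represented by a vector `v` with `⟨v, v⟩ = -1` and
`v⁰ > 0`. -/
theorem exists_eq_pt (x : Space n) :
    ∃ (v : Fin (n + 1) → ℝ) (hv : form v v < 0), x = pt v hv ∧ form v v = -1 ∧ 0 < v 0 := by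
  have hx : form x.rep x.rep < 0 := x.2
  have h0 : x.rep 0 ≠ 0 := apply_zero_ne_zero hx
  have hs : 0 < √(-form x.rep x.rep) := Real.sqrt_pos.mpr (by linarith)
  have hs2 : √(-form x.rep x.rep) ^ 2 = -form x.rep x.rep := Real.sq_sqrt (by linarith)
  have hsign : SignType.sign (x.rep 0) * SignType.sign (x.rep 0) = (1 : ℝ) := by
    rcases lt_or_gt_of_ne h0 with h | h <;> simp [h]
  have key : form ((SignType.sign (x.rep 0) / √(-form x.rep x.rep) : ℝ) • x.rep)
      ((SignType.sign (x.rep 0) / √(-form x.rep x.rep) : ℝ) • x.rep) = -1 := by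
    rw [form_smul_smul, div_mul_div_comm, hsign, ← sq, hs2]
    have := hx.ne
    field_simp
  refine ⟨_, by rw [key]; norm_num, ?_, key, ?_⟩
  · conv_lhs => rw [← pt_rep x]
    refine (pt_eq_pt _ _ rfl).symm
  · rw [Pi.smul_apply, smul_eq_mul, div_mul_eq_mul_div, sign_mul_self]
    positivity

theorem smul_pt (g : O1 n) (v : Fin (n + 1) → ℝ) (hv : form v v < 0) :
    g • pt v hv = pt (g.1.1.mulVec v) (by rwa [g.2]) :=
  Subtype.ext <| Projectivization.smul_mk _ _

theorem gdist_pt (v w : Fin (n + 1) → ℝ) (hv : form v v < 0) (hw : form w w < 0) :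
    gdist (pt v hv) (pt w hw) = Real.arcosh (|form v w| / √(form v v * form w w)) := by
  obtain ⟨a, ha, h⟩ := exists_pt_rep_eq v hv
  obtain ⟨b, hb, h'⟩ := exists_pt_rep_eq w hw
  have h1 : a * a * form v v * (b * b * form w w) = (a * b) ^ 2 * (form v v * form w w) := by ring
  rw [gdist, h, h', form_smul_smul, form_smul_smul, form_smul_smul, h1,
    Real.sqrt_mul (sq_nonneg _), Real.sqrt_sq_eq_abs, abs_mul,
    mul_div_mul_left _ _ (abs_ne_zero.mpr (mul_ne_zero ha hb))]

theorem gdist_smul (g : O1 n) (x y : Space n) : gdist (g • x) (g • y) = gdist x y := by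
  obtain ⟨v, hv, rfl, -⟩ := exists_eq_pt x
  obtain ⟨w, hw, rfl, -⟩ := exists_eq_pt y
  rw [smul_pt, smul_pt, gdist_pt, gdist_pt, g.2, g.2, g.2]

/-- The set of points whose future-directed representatives have positive product with `v`. For
spacelike `v` this is an open half-space with normal vector `v`. -/
def posSide (v : Fin (n + 1) → ℝ) : Set (Space n) :=
  {p | 0 < p.rep 0 * form v p.rep}

theorem pt_mem_posSide {v w : Fin (n + 1) → ℝ} (hw : form w w < 0) :
    pt w hw ∈ posSide v ↔ 0 < w 0 * form v w := by
  obtain ⟨a, ha, h⟩ := exists_pt_rep_eq w hw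
  have h1 : (a • w) 0 * form v (a • w) = (a * a) * (w 0 * form v w) := by
    rw [form_smul_right, Pi.smul_apply, smul_eq_mul]
    ring
  rw [posSide, Set.mem_ofPred_eq, h, h1, mul_pos_iff_of_pos_left (mul_self_pos.mpr ha)]

theorem posSide_smul {a : ℝ} (ha : 0 < a) (v : Fin (n + 1) → ℝ) :
    posSide (a • v) = posSide v := by
  ext p
  rw [posSide, posSide, Set.mem_ofPred_eq, Set.mem_ofPred_eq, form_smul_left, mul_left_comm,
    mul_pos_iff_of_pos_left ha]

/-- The factor `g₀₀` matters only through its sign: an element reversing the time orientation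
moves the half-space with normal vector `v` to the one with normal vector `-g v`. -/
theorem smul_posSide (g : O1 n) (v : Fin (n + 1) → ℝ) :
    g • posSide v = posSide (g.1.1 0 0 • g.1.1.mulVec v) := by
  ext p
  rw [Set.mem_smul_set_iff_inv_smul_mem]
  obtain ⟨w, hw, hp⟩ : ∃ w hw, g⁻¹ • p = pt w hw := ⟨_, _, (pt_rep _).symm⟩
  rw [hp, pt_mem_posSide]
  obtain rfl : p = g • pt w hw := by rw [← hp, smul_inv_smul]
  rw [smul_pt, pt_mem_posSide, form_smul_left, g.2]
  have h1 : w 0 ≠ 0 := apply_zero_ne_zero hw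
  have h2 := mulVec_zero_mul_pos g hw
  have h3 : g.1.1.mulVec w 0 * (g.1.1 0 0 * form v w) * w 0 ^ 2 =
      g.1.1 0 0 * (g.1.1.mulVec w 0 * w 0) * (w 0 * form v w) := by ring
  rw [← mul_pos_iff_of_pos_right (a := g.1.1.mulVec w 0 * (g.1.1 0 0 * form v w))
    (show 0 < w 0 ^ 2 by positivity), h3, mul_pos_iff_of_pos_left h2]

theorem smul_posSide_of_pos {g : O1 n} (hg : 0 < g.1.1 0 0) (v : Fin (n + 1) → ℝ) :
    g • posSide v = posSide (g.1.1.mulVec v) := by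
  rw [smul_posSide, posSide_smul hg]

/-- Reflections in spacelike vectors preserve the time orientation. -/
theorem refl_zero_zero_pos {w : Fin (n + 1) → ℝ} (hw : 0 < form w w) :
    0 < (refl w hw.ne').1.1 0 0 := by
  have h0 : (refl w hw.ne').1.1.mulVec (Pi.single 0 1) 0 = (refl w hw.ne').1.1 0 0 := by simp
  rw [← h0, refl_mulVec, form_comm, form_single_zero]
  simp only [Pi.sub_apply, Pi.single_eq_same, Pi.smul_apply, smul_eq_mul]
  have : 1 - 2 * -w 0 / form w w * w 0 = 1 + 2 * (w 0 ^ 2 / form w w) := by ring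
  rw [this]
  positivity

end Points

/-! ### The space of half-spaces and normal vectors -/

section HalfSpaces

variable {n : ℕ}

/-- The last basis vector, the normal vector of the half-space `H₀`. -/
def lastVec (n : ℕ) : Fin (n + 1) → ℝ := Pi.single (Fin.last n) 1

theorem form_lastVec (x : Fin (n + 1 + 1) → ℝ) :
    form (lastVec (n + 1)) x = x (Fin.last (n + 1)) := by
  rw [lastVec, ← Fin.succ_last, form_single_succ]

theorem form_lastVec_self : form (lastVec (n + 1)) (lastVec (n + 1)) = 1 := by
  rw [form_lastVec, lastVec, Pi.single_eq_same]

theorem stdHalfSpace_eq : stdHalfSpace (n + 1) = posSide (lastVec (n + 1)) := by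
  ext p
  rw [posSide, Set.mem_ofPred_eq, form_lastVec]
  rfl

theorem HalfSpace.ofGroup_val (g : O1 (n + 1)) :
    (HalfSpace.ofGroup g).1 = posSide (g.1.1 0 0 • g.1.1.mulVec (lastVec (n + 1))) := by
  rw [← smul_posSide, ← stdHalfSpace_eq]
  rfl

theorem HalfSpace.ofGroup_surjective (H : HalfSpace n) : ∃ g, HalfSpace.ofGroup g = H := by
  obtain ⟨-, g, rfl⟩ := H
  exact ⟨g, rfl⟩

theorem HalfSpace.smul_val (g : O1 n) (H : HalfSpace n) : (g • H).1 = g • H.1 := rfl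

theorem HalfSpace.smul_ofGroup (g h : O1 n) :
    g • HalfSpace.ofGroup h = HalfSpace.ofGroup (g * h) :=
  Subtype.ext (mul_smul g h (stdHalfSpace n)).symm

/-- Every half-space has a unit normal vector. -/
theorem HalfSpace.exists_val_eq (H : HalfSpace (n + 1)) :
    ∃ v, form v v = 1 ∧ H.1 = posSide v := by
  obtain ⟨g, rfl⟩ := H.ofGroup_surjective
  have h0 : 0 < |g.1.1 0 0| := abs_pos.mpr (apply_zero_zero_ne_zero g)
  refine ⟨(g.1.1 0 0 / |g.1.1 0 0|) • g.1.1.mulVec (lastVec (n + 1)), ?_, ?_⟩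
  · rw [form_smul_smul, g.2, form_lastVec_self, div_mul_div_comm, abs_mul_abs_self, mul_one,
      div_self (mul_self_pos.mpr (apply_zero_zero_ne_zero g)).ne']
  · rw [HalfSpace.ofGroup_val, div_eq_inv_mul, mul_smul, posSide_smul (inv_pos.mpr h0)]

theorem form_self_smul_inv_sqrt {v : Fin (n + 1) → ℝ} (hv : 0 < form v v) :
    form ((√(form v v))⁻¹ • v) ((√(form v v))⁻¹ • v) = 1 := by
  rw [form_smul_smul, ← mul_inv, Real.mul_self_sqrt hv.le, inv_mul_cancel₀ hv.ne']

/-- If `c` preserves the time orientation and moves the last basis vector to `u`, a reflection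
times `c` moves `H₀` to the half-space with normal vector `v`. -/
theorem ofGroup_refl_mul_val {c : O1 (n + 1)} (hc : 0 < c.1.1 0 0) {v : Fin (n + 1 + 1) → ℝ}
    (hv : form v v = 1)
    (hw : 0 < form (c.1.1.mulVec (lastVec (n + 1)) - v) (c.1.1.mulVec (lastVec (n + 1)) - v)) :
    (HalfSpace.ofGroup (refl _ hw.ne' * c)).1 = posSide v := by
  rw [← HalfSpace.smul_ofGroup, HalfSpace.smul_val, HalfSpace.ofGroup_val, posSide_smul hc,
    smul_posSide_of_pos (refl_zero_zero_pos hw), refl_sub_mulVec]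
  rw [c.2, form_lastVec_self, hv]

theorem exists_mulVec_lastVec_eq (s : ℝ) (hs : s = 1 ∨ s = -1) :
    ∃ c : O1 (n + 1), 0 < c.1.1 0 0 ∧ c.1.1.mulVec (lastVec (n + 1)) = s • lastVec (n + 1) := by
  rcases hs with rfl | rfl
  · exact ⟨1, by simp, by simp⟩
  · have h : 0 < form (lastVec (n + 1)) (lastVec (n + 1)) := by
      rw [form_lastVec_self]; exact one_pos
    refine ⟨refl _ h.ne', refl_zero_zero_pos h, ?_⟩
    rw [refl_mulVec, form_lastVec_self, mul_one, div_one]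
    module

theorem form_smul_lastVec_sub_pos {s : ℝ} (hs : s = 1 ∨ s = -1) {v : Fin (n + 1 + 1) → ℝ}
    (hv : form v v = 1) (h : s * v (Fin.last (n + 1)) < 1) :
    0 < form (s • lastVec (n + 1) - v) (s • lastVec (n + 1) - v) := by
  have h2 : s * s = 1 := by rcases hs with rfl | rfl <;> norm_num
  have h3 : form (s • lastVec (n + 1) - v) (s • lastVec (n + 1) - v) =
      s * s - 2 * (s * v (Fin.last (n + 1))) + 1 := by
    rw [form_sub_left, form_sub_right, form_sub_right, form_smul_smul, form_lastVec_self, hv,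
      form_comm v, form_smul_left, form_lastVec]
    ring
  linarith

theorem exists_sign_mul_lt_one (a : ℝ) : ∃ s : ℝ, (s = 1 ∨ s = -1) ∧ s * a < 1 := by
  rcases le_or_gt a 0 with h | h
  · exact ⟨1, Or.inl rfl, by linarith⟩
  · exact ⟨-1, Or.inr rfl, by linarith⟩

theorem posSide_mem_orbit {v : Fin (n + 1 + 1) → ℝ} (hv : 0 < form v v) :
    posSide v ∈ MulAction.orbit (O1 (n + 1)) (stdHalfSpace (n + 1)) := by
  obtain ⟨s, hs, hlt⟩ := exists_sign_mul_lt_one (((√(form v v))⁻¹ • v) (Fin.last (n + 1)))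
  obtain ⟨c, hc, hcs⟩ := exists_mulVec_lastVec_eq (n := n) s hs
  have hv1 := form_self_smul_inv_sqrt hv
  have hw := form_smul_lastVec_sub_pos hs hv1 hlt
  rw [← hcs] at hw
  refine ⟨refl _ hw.ne' * c, ?_⟩
  have := ofGroup_refl_mul_val hc hv1 hw
  rw [posSide_smul (inv_pos.mpr (Real.sqrt_pos.mpr hv))] at this
  exact this

open Classical in
/-- The half-space with normal vector `v`. For vectors `v` which are not spacelike, where
`posSide v` need not be a half-space, the value is irrelevant. -/
noncomputable def toHalfSpace (v : Fin (n + 1 + 1) → ℝ) : HalfSpace (n + 1) :=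
  if hv : 0 < form v v then ⟨posSide v, posSide_mem_orbit hv⟩ else HalfSpace.ofGroup 1

theorem toHalfSpace_val {v : Fin (n + 1 + 1) → ℝ} (hv : 0 < form v v) :
    (toHalfSpace v).1 = posSide v := by
  unfold toHalfSpace
  exact congrArg Subtype.val (dif_pos hv)

theorem HalfSpace.exists_toHalfSpace_eq (H : HalfSpace (n + 1)) :
    ∃ v, form v v = 1 ∧ toHalfSpace v = H := by
  obtain ⟨v, hv, hH⟩ := H.exists_val_eq
  exact ⟨v, hv, Subtype.ext (by rw [toHalfSpace_val (by rw [hv]; exact one_pos), hH])⟩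

theorem smul_toHalfSpace (g : O1 (n + 1)) {v : Fin (n + 1 + 1) → ℝ} (hv : 0 < form v v) :
    g • toHalfSpace v =
      toHalfSpace ((g.1.1 0 0 / |g.1.1 0 0|) • g.1.1.mulVec v) := by
  have h0 := apply_zero_zero_ne_zero g
  have h1 : 0 < form ((g.1.1 0 0 / |g.1.1 0 0|) • g.1.1.mulVec v)
      ((g.1.1 0 0 / |g.1.1 0 0|) • g.1.1.mulVec v) := by
    rw [form_smul_smul, g.2, div_mul_div_comm, abs_mul_abs_self,
      div_self (mul_self_pos.mpr h0).ne', one_mul]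
    exact hv
  refine Subtype.ext ?_
  rw [HalfSpace.smul_val, toHalfSpace_val hv, toHalfSpace_val h1, smul_posSide, div_eq_inv_mul,
    mul_smul, posSide_smul (inv_pos.mpr (abs_pos.mpr h0))]

theorem continuous_ofGroup : Continuous (HalfSpace.ofGroup : O1 n → HalfSpace n) :=
  continuous_coinduced_rng

theorem continuousOn_toHalfSpace :
    ContinuousOn (toHalfSpace (n := n)) {v | 0 < form v v} := by
  intro v₀ hv₀
  refine ContinuousAt.continuousWithinAt ?_
  obtain ⟨s, hs, hlt⟩ := exists_sign_mul_lt_one (((√(form v₀ v₀))⁻¹ • v₀) (Fin.last (n + 1)))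
  obtain ⟨c, hc, hcs⟩ := exists_mulVec_lastVec_eq (n := n) s hs
  have hcont : ContinuousOn
      (fun v : Fin (n + 1 + 1) → ℝ => (√(form v v))⁻¹ • v) {v | 0 < form v v} :=
    ContinuousOn.smul (ContinuousOn.inv₀ (by fun_prop) fun v hv => (Real.sqrt_pos.mpr hv).ne')
      continuousOn_id
  obtain ⟨U, hUdef⟩ : ∃ U, U = {v : Fin (n + 1 + 1) → ℝ | 0 < form v v} ∩
      (fun v => (√(form v v))⁻¹ • v) ⁻¹' {w | s * w (Fin.last (n + 1)) < 1} := ⟨_, rfl⟩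
  have hU : IsOpen U := hUdef ▸ hcont.isOpen_inter_preimage
    (isOpen_lt continuous_const (by fun_prop)) (isOpen_lt (by fun_prop) continuous_const)
  have hU1 : ∀ v ∈ U, 0 < form v v := fun v hv => (hUdef ▸ hv).1
  have hU2 : ∀ v ∈ U, s * ((√(form v v))⁻¹ • v) (Fin.last (n + 1)) < 1 :=
    fun v hv => (hUdef ▸ hv).2
  refine ContinuousOn.continuousAt ?_ (hU.mem_nhds (hUdef ▸ ⟨hv₀, hlt⟩))
  rw [continuousOn_iff_continuous_domRestrict]
  -- near `v₀` the reflection moving `s • lastVec` to the normalization of `v` is defined and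
  -- depends continuously on `v`
  have hw : ∀ v : U, 0 < form (c.1.1.mulVec (lastVec (n + 1)) - (√(form v.1 v.1))⁻¹ • v.1)
      (c.1.1.mulVec (lastVec (n + 1)) - (√(form v.1 v.1))⁻¹ • v.1) := fun v => by
    rw [hcs]
    exact form_smul_lastVec_sub_pos hs (form_self_smul_inv_sqrt (hU1 v v.2)) (hU2 v v.2)
  have hr := continuous_refl (continuous_const.sub
    (continuousOn_iff_continuous_domRestrict.mp (hcont.mono hU1))) fun v => (hw v).ne'
  refine (continuous_ofGroup.comp (hr.mul (continuous_const (y := c)))).congr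
    fun v => Subtype.ext ?_
  rw [Set.domRestrict_apply, toHalfSpace_val (hU1 v v.2)]
  refine (ofGroup_refl_mul_val hc (form_self_smul_inv_sqrt (hU1 v v.2)) (hw v)).trans ?_
  rw [posSide_smul (inv_pos.mpr (Real.sqrt_pos.mpr (hU1 v v.2)))]

end HalfSpaces

/-! ### Half-spaces through a point -/

section Incidence

variable {n : ℕ}

theorem mem_halfSpacesThrough_ofGroup (x : Space (n + 1)) (g : O1 (n + 1)) :
    HalfSpace.ofGroup g ∈ halfSpacesThrough x ↔ g⁻¹ • x ∈ posSide (lastVec (n + 1)) := by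
  rw [← Set.mem_smul_set_iff_inv_smul_mem, ← stdHalfSpace_eq]
  rfl

theorem mem_halfSpacesThrough_toHalfSpace {v w : Fin (n + 1 + 1) → ℝ} (hw : form w w < 0)
    (hv : 0 < form v v) :
    toHalfSpace v ∈ halfSpacesThrough (pt w hw) ↔ 0 < w 0 * form v w := by
  rw [← pt_mem_posSide hw, ← toHalfSpace_val hv]
  rfl

theorem smul_mem_halfSpacesThrough_smul (g : O1 n) (x : Space n) (H : HalfSpace n) :
    g • H ∈ halfSpacesThrough (g • x) ↔ H ∈ halfSpacesThrough x :=
  Set.smul_mem_smul_set_iff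

theorem preimage_smul_halfSpacesThrough (g : O1 n) (x : Space n) :
    (g • ·) ⁻¹' halfSpacesThrough (g • x) = halfSpacesThrough x :=
  Set.ext fun H => smul_mem_halfSpacesThrough_smul g x H

theorem isOpen_setOf_inv_smul_mem_posSide (x : Space n) (v : Fin (n + 1) → ℝ) :
    IsOpen {g : O1 n | g⁻¹ • x ∈ posSide v} := by
  obtain ⟨w, hw, rfl, -⟩ := exists_eq_pt x
  simp only [smul_pt, pt_mem_posSide]
  have h : Continuous fun g : O1 n => (g⁻¹).1.1.mulVec w :=
    (Units.continuous_val.comp (continuous_subtype_val.comp continuous_inv)).matrix_mulVec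
      continuous_const
  exact isOpen_lt continuous_const
    (((continuous_apply 0).comp h).mul (continuous_form continuous_const h))

theorem isOpen_halfSpacesThrough (x : Space (n + 1)) : IsOpen (halfSpacesThrough x) := by
  refine isOpen_coinduced.mpr ?_
  convert isOpen_setOf_inv_smul_mem_posSide x (lastVec (n + 1)) using 1
  ext g
  exact mem_halfSpacesThrough_ofGroup x g

theorem measurableSet_halfSpacesThrough (x : Space (n + 1)) :
    MeasurableSet (halfSpacesThrough x) :=
  (isOpen_halfSpacesThrough x).measurableSet

theorem continuous_smul_halfSpace (g : O1 n) : Continuous fun H : HalfSpace n => g • H := by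
  refine continuous_coinduced_dom.mpr ?_
  exact (continuous_ofGroup.comp (continuous_const.mul continuous_id)).congr
    fun h => (HalfSpace.smul_ofGroup g h).symm

theorem isOpenMap_ofGroup : IsOpenMap (HalfSpace.ofGroup : O1 n → HalfSpace n) := by
  intro U hU
  refine isOpen_coinduced.mpr ?_
  have : HalfSpace.ofGroup ⁻¹' (HalfSpace.ofGroup '' U) =
      ⋃ h ∈ MulAction.stabilizer (O1 n) (stdHalfSpace n), (· * h) ⁻¹' U := by
    ext g
    simp only [Set.mem_preimage, Set.mem_image, Set.mem_iUnion, MulAction.mem_stabilizer_iff]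
    constructor
    · rintro ⟨g', hg', h⟩
      refine ⟨g⁻¹ * g', ?_, by rwa [mul_inv_cancel_left]⟩
      rw [mul_smul, inv_smul_eq_iff]
      exact congrArg Subtype.val h
    · rintro ⟨h, hh, hU⟩
      refine ⟨g * h, hU, Subtype.ext ?_⟩
      change (g * h) • stdHalfSpace n = g • stdHalfSpace n
      rw [mul_smul, hh]
  rw [this]
  exact isOpen_biUnion fun h _ => hU.preimage (continuous_mul_const h)

instance : SecondCountableTopology (O1 n) :=
  have : SecondCountableTopology (GL (Fin (n + 1)) ℝ) :=
    have : SecondCountableTopology (Matrix (Fin (n + 1)) (Fin (n + 1)) ℝ) :=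
      inferInstanceAs (SecondCountableTopology (Fin (n + 1) → Fin (n + 1) → ℝ))
    have : SecondCountableTopology (Matrix (Fin (n + 1)) (Fin (n + 1)) ℝ)ᵐᵒᵖ :=
      MulOpposite.opHomeomorph.symm.secondCountableTopology
    Units.isEmbedding_embedProduct.secondCountableTopology
  TopologicalSpace.Subtype.secondCountableTopology _

instance : SecondCountableTopology (HalfSpace n) :=
  (isOpenMap_ofGroup.isQuotientMap continuous_ofGroup
    HalfSpace.ofGroup_surjective).secondCountableTopology isOpenMap_ofGroup

end Incidence

/-! ### A geodesic -/

section Geodesic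

variable {n : ℕ}

/-- The vectors `(cosh t, 0, …, 0, sinh t)`. -/
noncomputable def geodVec (n : ℕ) (t : ℝ) : Fin (n + 1) → ℝ :=
  Real.cosh t • Pi.single 0 1 + Real.sinh t • lastVec n

theorem form_geodVec (v : Fin (n + 1 + 1) → ℝ) (t : ℝ) :
    form v (geodVec (n + 1) t) = -(Real.cosh t * v 0) + Real.sinh t * v (Fin.last (n + 1)) := by
  rw [geodVec, form_add_right, form_smul_right, form_smul_right, form_comm, form_single_zero,
    form_comm v, form_lastVec]
  ring

theorem geodVec_zero (t : ℝ) : geodVec (n + 1) t 0 = Real.cosh t := by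
  simp [geodVec, lastVec, (Fin.last_pos (n := n)).ne]

theorem geodVec_last (t : ℝ) : geodVec (n + 1) t (Fin.last (n + 1)) = Real.sinh t := by
  simp [geodVec, lastVec]

theorem form_geodVec_geodVec (s t : ℝ) :
    form (geodVec (n + 1) s) (geodVec (n + 1) t) = -Real.cosh (s - t) := by
  rw [form_geodVec, geodVec_zero, geodVec_last, Real.cosh_sub]
  ring

theorem form_geodVec_self (t : ℝ) : form (geodVec (n + 1) t) (geodVec (n + 1) t) = -1 := by
  rw [form_geodVec_geodVec, sub_self, Real.cosh_zero]

theorem form_geodVec_self_neg (t : ℝ) : form (geodVec (n + 1) t) (geodVec (n + 1) t) < 0 := by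
  rw [form_geodVec_self]
  norm_num

/-- The unit speed geodesic through the base point `(1, 0, …, 0)` orthogonal to the boundary of
`H₀`. -/
noncomputable def geod (n : ℕ) (t : ℝ) : Space (n + 1) :=
  pt (geodVec (n + 1) t) (form_geodVec_self_neg t)

theorem gdist_geod (s t : ℝ) : gdist (geod n s) (geod n t) = |s - t| := by
  rw [geod, geod, gdist_pt, form_geodVec_self, form_geodVec_self, form_geodVec_geodVec, abs_neg,
    abs_of_pos (Real.cosh_pos _), neg_mul_neg, one_mul, Real.sqrt_one, div_one, ← Real.cosh_abs,
    Real.arcosh_cosh (abs_nonneg _)]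

theorem toHalfSpace_mem_halfSpacesThrough_geod {v : Fin (n + 1 + 1) → ℝ} (hv : 0 < form v v)
    (t : ℝ) : toHalfSpace v ∈ halfSpacesThrough (geod n t) ↔ 0 < form v (geodVec (n + 1) t) := by
  rw [geod, mem_halfSpacesThrough_toHalfSpace _ hv, geodVec_zero,
    mul_pos_iff_of_pos_left (Real.cosh_pos t)]

theorem form_geodVec_mul_nonpos {v : Fin (n + 1 + 1) → ℝ} (hv : 0 < form v v) {s t : ℝ}
    (h : toHalfSpace v ∈ symmDiff (halfSpacesThrough (geod n s)) (halfSpacesThrough (geod n t))) :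
    form v (geodVec (n + 1) s) * form v (geodVec (n + 1) t) ≤ 0 := by
  rw [Set.mem_symmDiff, toHalfSpace_mem_halfSpacesThrough_geod hv,
    toHalfSpace_mem_halfSpacesThrough_geod hv, not_lt, not_lt] at h
  rcases h with ⟨h1, h2⟩ | ⟨h1, h2⟩
  · exact mul_nonpos_of_nonneg_of_nonpos h1.le h2
  · exact mul_nonpos_of_nonpos_of_nonneg h2 h1.le

/-- The normal vectors `v` with `⟨v, v⟩ ≤ 1` of the hyperplanes meeting a given segment of the
geodesic form a bounded set. -/
theorem mem_Icc_of_form_geodVec_mul_nonpos {v : Fin (n + 1 + 1) → ℝ} (hv : form v v ≤ 1) {t : ℝ}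
    (h : form v (geodVec (n + 1) t) * form v (geodVec (n + 1) (-t)) ≤ 0) :
    v ∈ Set.Icc (fun _ => -Real.cosh t) fun _ => Real.cosh t := by
  rw [form_geodVec, form_geodVec, Real.cosh_neg, Real.sinh_neg] at h
  rw [form_self] at hv
  have hle : ∀ i : Fin (n + 1), v i.succ ^ 2 ≤ 1 + v 0 ^ 2 := fun i =>
    (Finset.single_le_sum (f := fun i : Fin (n + 1) => v i.succ ^ 2) (fun _ _ => sq_nonneg _)
      (Finset.mem_univ i)).trans (by linarith)
  have hlast := hle (Fin.last n)
  rw [Fin.succ_last] at hlast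
  have hc := Real.cosh_sq t
  have h0 : v 0 ^ 2 ≤ Real.sinh t ^ 2 := by
    have h1 : Real.cosh t ^ 2 * v 0 ^ 2 ≤ Real.sinh t ^ 2 * v (Fin.last (n + 1)) ^ 2 := by
      linarith
    have h2 := mul_le_mul_of_nonneg_left hlast (sq_nonneg (Real.sinh t))
    rw [hc] at h1
    linarith
  have hall : ∀ i, v i ^ 2 ≤ Real.cosh t ^ 2 := by
    refine Fin.cases ?_ fun i => ?_
    · linarith
    · linarith [hle i]
  have habs : ∀ i, |v i| ≤ Real.cosh t := fun i =>
    abs_le_of_sq_le_sq (hall i) (Real.cosh_pos t).le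
  exact ⟨fun i => (abs_le.mp (habs i)).1, fun i => (abs_le.mp (habs i)).2⟩

theorem exists_isCompact_symmDiff_geod_subset (t : ℝ) :
    ∃ K : Set (HalfSpace (n + 1)), IsCompact K ∧
      symmDiff (halfSpacesThrough (geod n t)) (halfSpacesThrough (geod n (-t))) ⊆ K := by
  let A : Set (Fin (n + 1 + 1) → ℝ) := {v | form v v = 1} ∩
    Set.Icc (fun _ => -Real.cosh t) fun _ => Real.cosh t
  have hA : IsCompact A := isCompact_Icc.inter_left (isClosed_eq (by fun_prop) continuous_const)
  have hsub : A ⊆ {v | 0 < form v v} := fun v hv => by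
    rw [Set.mem_ofPred_eq, show form v v = 1 from hv.1]
    exact one_pos
  refine ⟨toHalfSpace '' A, hA.image_of_continuousOn (continuousOn_toHalfSpace.mono hsub), ?_⟩
  intro H hH
  obtain ⟨v, hv, rfl⟩ := H.exists_toHalfSpace_eq
  exact ⟨v, ⟨hv, mem_Icc_of_form_geodVec_mul_nonpos hv.le
    (form_geodVec_mul_nonpos (by rw [hv]; exact one_pos) hH)⟩, rfl⟩

/-- Every half-space has a neighbourhood all of whose elements separate two points, both taken
from a translate of the geodesic. -/
theorem exists_symmDiff_mem_nhds (H : HalfSpace (n + 1)) :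
    ∃ g : O1 (n + 1), symmDiff (halfSpacesThrough (g • geod n 1))
      (halfSpacesThrough (g • geod n (-1))) ∈ nhds H := by
  obtain ⟨g, rfl⟩ := H.ofGroup_surjective
  refine ⟨g, ?_⟩
  let U : Set (O1 (n + 1)) := {h | h⁻¹ • g • geod n 1 ∈ posSide (lastVec (n + 1))} ∩
    {h | h⁻¹ • g • geod n (-1) ∈ posSide (-lastVec (n + 1))}
  have hU : IsOpen U := (isOpen_setOf_inv_smul_mem_posSide _ _).inter
    (isOpen_setOf_inv_smul_mem_posSide _ _)
  have hpos : 0 < Real.cosh 1 * Real.sinh 1 :=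
    mul_pos (Real.cosh_pos 1) (Real.sinh_pos_iff.mpr one_pos)
  have hg : g ∈ U := by
    constructor
    · rw [Set.mem_ofPred_eq, inv_smul_smul, geod, pt_mem_posSide, geodVec_zero, form_lastVec,
        geodVec_last]
      exact hpos
    · rw [Set.mem_ofPred_eq, inv_smul_smul, geod, pt_mem_posSide, geodVec_zero, form_neg_left,
        form_lastVec, geodVec_last, Real.cosh_neg, Real.sinh_neg, neg_neg]
      exact hpos
  refine Filter.mem_of_superset ((isOpenMap_ofGroup U hU).mem_nhds ⟨g, hg, rfl⟩) ?_
  rintro - ⟨h, ⟨h1, h2⟩, rfl⟩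
  refine Or.inl ⟨(mem_halfSpacesThrough_ofGroup _ _).mpr h1, fun h3 => ?_⟩
  rw [mem_halfSpacesThrough_ofGroup] at h3
  obtain ⟨w, hw, hp⟩ : ∃ w hw, h⁻¹ • g • geod n (-1) = pt w hw := ⟨_, _, (pt_rep _).symm⟩
  rw [Set.mem_ofPred_eq, hp, pt_mem_posSide, form_neg_left] at h2
  rw [hp, pt_mem_posSide] at h3
  linarith

end Geodesic

/-! ### The invariant measure -/

section InvariantMeasure

variable {n : ℕ}

theorem isOpen_setOf_form_mem_Ioo :
    IsOpen {v : Fin (n + 1) → ℝ | form v v ∈ Set.Ioo (0 : ℝ) 1} :=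
  isOpen_Ioo.preimage (by fun_prop)

/-- The image of Lebesgue measure on the region `0 < ⟨v, v⟩ < 1` under the map sending a spacelike
vector to the half-space with that normal vector. -/
noncomputable def coneMeasure (n : ℕ) : Measure (HalfSpace (n + 1)) :=
  (volume.restrict {v | form v v ∈ Set.Ioo (0 : ℝ) 1}).map toHalfSpace

theorem aemeasurable_toHalfSpace :
    AEMeasurable (toHalfSpace (n := n))
      (volume.restrict {v | form v v ∈ Set.Ioo (0 : ℝ) 1}) :=
  (continuousOn_toHalfSpace.mono fun _ hv => hv.1).aemeasurable
    isOpen_setOf_form_mem_Ioo.measurableSet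

theorem coneMeasure_apply {s : Set (HalfSpace (n + 1))} (hs : MeasurableSet s) :
    coneMeasure n s =
      volume (toHalfSpace ⁻¹' s ∩ {v | form v v ∈ Set.Ioo (0 : ℝ) 1}) := by
  rw [coneMeasure, Measure.map_apply_of_aemeasurable aemeasurable_toHalfSpace hs,
    Measure.restrict_apply' isOpen_setOf_form_mem_Ioo.measurableSet]

theorem form_half_lastVec_mem :
    form ((1 / 2 : ℝ) • lastVec (n + 1)) ((1 / 2 : ℝ) • lastVec (n + 1)) ∈ Set.Ioo (0 : ℝ) 1 := by
  rw [form_smul_smul, form_lastVec_self]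
  norm_num

theorem coneMeasure_ne_zero : coneMeasure n ≠ 0 := by
  intro h
  have h1 := coneMeasure_apply (n := n) MeasurableSet.univ
  rw [h, Set.preimage_univ, Set.univ_inter, Measure.coe_zero, Pi.zero_apply] at h1
  exact (isOpen_setOf_form_mem_Ioo.measure_pos volume ⟨_, form_half_lastVec_mem⟩).ne h1

instance smulInvariantMeasure_coneMeasure :
    SMulInvariantMeasure (O1 (n + 1)) (HalfSpace (n + 1)) (coneMeasure n) where
  measure_preimage_smul g s hs := by
    have h0 := apply_zero_zero_ne_zero g
    have hε : |(g.1.1 0 0 / |g.1.1 0 0| : ℝ)| = 1 := by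
      rw [abs_div, abs_abs, div_self (abs_ne_zero.mpr h0)]
    obtain ⟨ε, hεdef⟩ : ∃ ε, ε = g.1.1 0 0 / |g.1.1 0 0| := ⟨_, rfl⟩
    rw [← hεdef] at hε
    let f : (Fin (n + 1 + 1) → ℝ) →ₗ[ℝ] (Fin (n + 1 + 1) → ℝ) := ε • Matrix.toLin' g.1.1
    have hf : ∀ v, f v = ε • g.1.1.mulVec v := fun v => rfl
    have hform : ∀ v, form (f v) (f v) = form v v := fun v => by
      rw [hf, form_smul_smul, g.2, ← abs_mul_abs_self, hε, one_mul, one_mul]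
    have hdet : |LinearMap.det f| = 1 := by
      rw [LinearMap.det_smul, LinearMap.det_toLin', abs_mul, abs_pow, hε, one_pow, one_mul,
        ← pow_eq_one_iff_of_nonneg (abs_nonneg _) two_ne_zero, sq_abs, det_sq_eq_one]
    have hdet0 : LinearMap.det f ≠ 0 := by
      rw [← abs_ne_zero, hdet]
      exact one_ne_zero
    rw [coneMeasure_apply ((continuous_smul_halfSpace g).measurable hs), coneMeasure_apply hs]
    have hset : toHalfSpace ⁻¹' ((g • ·) ⁻¹' s) ∩ {v | form v v ∈ Set.Ioo (0 : ℝ) 1} =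
        f ⁻¹' (toHalfSpace ⁻¹' s ∩ {v | form v v ∈ Set.Ioo (0 : ℝ) 1}) := by
      ext v
      simp only [Set.mem_inter_iff, Set.mem_preimage, Set.mem_ofPred_eq, hform]
      refine and_congr_left fun hv => ?_
      rw [smul_toHalfSpace g hv.1, ← hεdef, hf]
    rw [hset, Measure.addHaar_preimage_linearMap volume hdet0, abs_inv, hdet, inv_one,
      ENNReal.ofReal_one, one_mul]

theorem coneMeasure_symmDiff_geod_lt_top (t : ℝ) :
    coneMeasure n (symmDiff (halfSpacesThrough (geod n t)) (halfSpacesThrough (geod n (-t)))) <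
      ∞ := by
  rw [coneMeasure_apply ((measurableSet_halfSpacesThrough _).symmDiff
    (measurableSet_halfSpacesThrough _))]
  refine (measure_mono ?_).trans_lt (isCompact_Icc (a := fun _ : Fin (n + 1 + 1) => -Real.cosh t)
    (b := fun _ => Real.cosh t)).measure_lt_top
  rintro v ⟨hv, hv0, hv1⟩
  exact mem_Icc_of_form_geodVec_mul_nonpos hv1.le (form_geodVec_mul_nonpos hv0 hv)

/-- The measure of the half-spaces separating two points depends only on the orbit of the pair. -/
theorem measure_symmDiff_smul (μ : Measure (HalfSpace (n + 1)))
    [SMulInvariantMeasure (O1 (n + 1)) (HalfSpace (n + 1)) μ] (g : O1 (n + 1))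
    (x y : Space (n + 1)) :
    μ (symmDiff (halfSpacesThrough (g • x)) (halfSpacesThrough (g • y))) =
      μ (symmDiff (halfSpacesThrough x) (halfSpacesThrough y)) := by
  rw [← SMulInvariantMeasure.measure_preimage_smul g ((measurableSet_halfSpacesThrough _).symmDiff
    (measurableSet_halfSpacesThrough _)), Set.preimage_symmDiff, preimage_smul_halfSpacesThrough,
    preimage_smul_halfSpacesThrough]

theorem isInvariantMeasure_coneMeasure : IsInvariantMeasure (coneMeasure n) where
  ne_zero := coneMeasure_ne_zero
  invariant := smulInvariantMeasure_coneMeasure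
  finite_on_compacts := by
    have : IsLocallyFiniteMeasure (coneMeasure n) := ⟨fun H => by
      obtain ⟨g, hg⟩ := exists_symmDiff_mem_nhds H
      refine ⟨_, hg, ?_⟩
      rw [measure_symmDiff_smul]
      exact coneMeasure_symmDiff_geod_lt_top 1⟩
    infer_instance

end InvariantMeasure

/-! ### Two-point homogeneity -/

section Homogeneity

variable {n : ℕ}

theorem geodVec_zero_eq : geodVec n 0 = Pi.single 0 1 := by
  simp [geodVec]

theorem exists_smul_eq_geod_zero (x : Space (n + 1)) : ∃ g : O1 (n + 1), g • x = geod n 0 := by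
  obtain ⟨v, hv, rfl, hv1, hv0⟩ := exists_eq_pt x
  have he : form (geodVec (n + 1) 0) (geodVec (n + 1) 0) = -1 := form_geodVec_self 0
  have hve : form (geodVec (n + 1) 0) v = -v 0 := by rw [geodVec_zero_eq, form_single_zero]
  have hneg : form (-geodVec (n + 1) 0) (-geodVec (n + 1) 0) = -1 := by
    rw [form_neg_left, form_comm, form_neg_left, neg_neg, he]
  -- `v` is moved to `-e₀` rather than `e₀`, so that the vector `v + e₀` of the reflection is
  -- never isotropic
  have hw : form (v - -geodVec (n + 1) 0) (v - -geodVec (n + 1) 0) ≠ 0 := by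
    rw [form_sub_left, form_sub_right, form_sub_right, hneg, form_comm v (-_), form_neg_left, hve,
      hv1]
    intro h
    linarith
  refine ⟨refl _ hw, ?_⟩
  rw [smul_pt]
  refine pt_eq_pt _ _ (a := -1) ?_
  rw [refl_sub_mulVec (by rw [hv1, hneg]), neg_one_smul]

theorem exists_smul_eq_geod_of_geod_zero (y : Space (n + 1)) :
    ∃ (g : O1 (n + 1)) (t : ℝ), 0 ≤ t ∧ g • geod n 0 = geod n 0 ∧ g • y = geod n t := by
  obtain ⟨u, hu, rfl, hu1, hu0⟩ := exists_eq_pt y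
  obtain ⟨t, ht, ht0⟩ : ∃ t : ℝ, 0 ≤ t ∧ Real.cosh t = u 0 := by
    have h1 : 1 ≤ u 0 := by
      rw [form_self] at hu1
      have : 0 ≤ ∑ i : Fin (n + 1), u i.succ ^ 2 := Finset.sum_nonneg fun i _ => sq_nonneg _
      nlinarith
    exact ⟨Real.arcosh (u 0), Real.arcosh_nonneg h1, Real.cosh_arcosh h1⟩
  have hzero : (u - geodVec (n + 1) t) 0 = 0 := by
    rw [Pi.sub_apply, geodVec_zero, ht0, sub_self]
  by_cases hw : form (u - geodVec (n + 1) t) (u - geodVec (n + 1) t) = 0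
  · refine ⟨1, t, ht, one_smul _ _, ?_⟩
    rw [one_smul, geod]
    refine pt_eq_pt _ _ (a := 1) ?_
    rw [form_self, hzero, zero_pow two_ne_zero, neg_zero, zero_add,
      Finset.sum_eq_zero_iff_of_nonneg fun _ _ => sq_nonneg _] at hw
    have h : u - geodVec (n + 1) t = 0 := by
      funext i
      refine Fin.cases hzero (fun j => ?_) i
      exact pow_eq_zero_iff two_ne_zero |>.mp (hw j (Finset.mem_univ j))
    rw [one_smul, sub_eq_zero.mp h]
  · refine ⟨refl _ hw, t, ht, ?_, ?_⟩
    · rw [geod, smul_pt]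
      refine pt_eq_pt _ _ (a := 1) ?_
      rw [one_smul, refl_mulVec, form_comm, geodVec_zero_eq, form_single_zero, hzero]
      simp
    · rw [smul_pt]
      refine pt_eq_pt _ _ (a := 1) ?_
      rw [one_smul, refl_sub_mulVec (by rw [hu1, form_geodVec_self])]

/-- The pairs of points of hyperbolic space are classified up to isometry by their distance. -/
theorem exists_smul_eq_geod (x y : Space (n + 1)) :
    ∃ g : O1 (n + 1), 0 ≤ gdist x y ∧ g • x = geod n 0 ∧ g • y = geod n (gdist x y) := by
  obtain ⟨g, hg⟩ := exists_smul_eq_geod_zero x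
  obtain ⟨h, t, ht, h0, h1⟩ := exists_smul_eq_geod_of_geod_zero (g • y)
  have hd : gdist x y = t := by
    rw [← gdist_smul (h * g), mul_smul, mul_smul, hg, h0, h1, gdist_geod, zero_sub, abs_neg,
      abs_of_nonneg ht]
  refine ⟨h * g, hd ▸ ht, ?_, ?_⟩
  · rw [mul_smul, hg, h0]
  · rw [mul_smul, h1, hd]

end Homogeneity

/-! ### The Crofton formula -/

section Crofton

variable {n : ℕ}

theorem sinh_mul_form_geodVec (v : Fin (n + 1 + 1) → ℝ) (s u : ℝ) :
    Real.sinh u * form v (geodVec (n + 1) s) =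
      Real.sinh (u - s) * form v (geodVec (n + 1) 0) +
        Real.sinh s * form v (geodVec (n + 1) u) := by
  simp only [form_geodVec, Real.sinh_sub, Real.cosh_zero, Real.sinh_zero]
  ring

/-- Half-spaces and their complements are convex: the middle one of three points on the geodesic
lies on the side of the two others if these are on the same side. -/
theorem mem_halfSpacesThrough_geod_of_between (H : HalfSpace (n + 1)) {s u : ℝ} (hs : 0 ≤ s)
    (hsu : s ≤ u)
    (h : H ∈ halfSpacesThrough (geod n 0) ↔ H ∈ halfSpacesThrough (geod n u)) :
    H ∈ halfSpacesThrough (geod n s) ↔ H ∈ halfSpacesThrough (geod n 0) := by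
  rcases hs.eq_or_lt with rfl | hs0
  · rfl
  obtain ⟨v, hv, rfl⟩ := H.exists_toHalfSpace_eq
  have hv0 : 0 < form v v := by rw [hv]; exact one_pos
  simp only [toHalfSpace_mem_halfSpacesThrough_geod hv0] at h ⊢
  have key := sinh_mul_form_geodVec v s u
  have h1 : 0 < Real.sinh u := Real.sinh_pos_iff.mpr (hs0.trans_le hsu)
  have h2 : 0 < Real.sinh s := Real.sinh_pos_iff.mpr hs0
  have h3 : 0 ≤ Real.sinh (u - s) := Real.sinh_nonneg_iff.mpr (sub_nonneg.mpr hsu)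
  constructor
  · intro hs
    by_contra hneg
    have hu : ¬0 < form v (geodVec (n + 1) u) := fun hu => hneg (h.mpr hu)
    rw [not_lt] at hneg hu
    have := mul_nonpos_of_nonneg_of_nonpos h3 hneg
    have := mul_nonpos_of_nonneg_of_nonpos h2.le hu
    have := mul_pos h1 hs
    linarith
  · intro hpos
    refine pos_of_mul_pos_right (a := Real.sinh u) ?_ h1.le
    rw [key]
    exact add_pos_of_nonneg_of_pos (mul_nonneg h3 hpos.le) (mul_pos h2 (h.mp hpos))

/-- A half-space separates the end points of a geodesic segment exactly if it separates the end
points of one of the two parts into which a third point divides the segment, and then of only one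
of them. -/
theorem symmDiff_geod_eq_union {s u : ℝ} (hs : 0 ≤ s) (hsu : s ≤ u) :
    symmDiff (halfSpacesThrough (geod n 0)) (halfSpacesThrough (geod n u)) =
        symmDiff (halfSpacesThrough (geod n 0)) (halfSpacesThrough (geod n s)) ∪
          symmDiff (halfSpacesThrough (geod n s)) (halfSpacesThrough (geod n u)) ∧
      Disjoint (symmDiff (halfSpacesThrough (geod n 0)) (halfSpacesThrough (geod n s)))
        (symmDiff (halfSpacesThrough (geod n s)) (halfSpacesThrough (geod n u))) := by
  have h := fun H => mem_halfSpacesThrough_geod_of_between (n := n) H hs hsu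
  constructor
  · ext H
    specialize h H
    simp only [Set.mem_union, Set.mem_symmDiff]
    tauto
  · rw [Set.disjoint_left]
    intro H
    specialize h H
    simp only [Set.mem_symmDiff]
    tauto

theorem eq_mul_of_additive_of_nonneg {F : ℝ → ℝ}
    (hadd : ∀ s t, 0 ≤ s → 0 ≤ t → F (s + t) = F s + F t) (hpos : ∀ t, 0 ≤ t → 0 ≤ F t) {t : ℝ}
    (ht : 0 ≤ t) : F t = t * F 1 := by
  have hmono : ∀ s t, 0 ≤ s → s ≤ t → F s ≤ F t := fun s t hs hst => by
    have h := hadd s (t - s) hs (sub_nonneg.mpr hst)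
    rw [add_sub_cancel] at h
    linarith [hpos (t - s) (sub_nonneg.mpr hst)]
  have h0 : F 0 = 0 := by
    have := hadd 0 0 le_rfl le_rfl
    rw [add_zero] at this
    linarith
  have hnat : ∀ (m : ℕ) (s : ℝ), 0 ≤ s → F (m * s) = m * F s := fun m s hs => by
    induction m with
    | zero => simp [h0]
    | succ m ih =>
      rw [Nat.cast_succ, add_one_mul, hadd _ _ (by positivity) hs, ih]
      ring
  have hnat1 : ∀ m : ℕ, F m = m * F 1 := fun m => by simpa using hnat m 1 zero_le_one
  have hbound : ∀ N : ℕ, N * |F t - t * F 1| ≤ F 1 := fun N => by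
    have hN : 0 ≤ N * t := by positivity
    have hl := hmono _ _ (Nat.cast_nonneg _) (Nat.floor_le hN)
    have hr := hmono _ _ hN (Nat.lt_floor_add_one (N * t)).le
    rw [hnat N t ht] at hl hr
    rw [hnat1] at hl
    rw [show (⌊N * t⌋₊ : ℝ) + 1 = (⌊N * t⌋₊ + 1 : ℕ) by push_cast; rfl, hnat1] at hr
    push_cast at hr
    have h1 := mul_le_mul_of_nonneg_right (Nat.floor_le hN) (hpos 1 zero_le_one)
    have h2 := mul_le_mul_of_nonneg_right (Nat.lt_floor_add_one (N * t)).le (hpos 1 zero_le_one)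
    have habs : (N : ℝ) * |F t - t * F 1| = |N * F t - N * t * F 1| := by
      rw [← abs_of_nonneg (Nat.cast_nonneg (α := ℝ) N), ← abs_mul,
        abs_of_nonneg (Nat.cast_nonneg (α := ℝ) N)]
      ring_nf
    rw [habs, abs_le]
    constructor <;> linarith
  by_contra hne
  have hd : 0 < |F t - t * F 1| := abs_pos.mpr (sub_ne_zero.mpr hne)
  obtain ⟨N, hN⟩ := exists_nat_gt (F 1 / |F t - t * F 1|)
  rw [div_lt_iff₀ hd] at hN
  exact absurd (hbound N) (not_le.mpr hN)

variable {μ : Measure (HalfSpace (n + 1))}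

theorem IsInvariantMeasure.measure_symmDiff_eq (hμ : IsInvariantMeasure μ)
    (x y : Space (n + 1)) :
    μ (symmDiff (halfSpacesThrough x) (halfSpacesThrough y)) =
      μ (symmDiff (halfSpacesThrough (geod n 0)) (halfSpacesThrough (geod n (gdist x y)))) := by
  have := hμ.invariant
  obtain ⟨g, -, h1, h2⟩ := exists_smul_eq_geod x y
  rw [← measure_symmDiff_smul μ g, h1, h2]

theorem IsInvariantMeasure.measure_symmDiff_ne_top (hμ : IsInvariantMeasure μ)
    (x y : Space (n + 1)) : μ (symmDiff (halfSpacesThrough x) (halfSpacesThrough y)) ≠ ∞ := by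
  have := hμ.finite_on_compacts
  obtain ⟨-, hd, -⟩ := exists_smul_eq_geod x y
  obtain ⟨K, hK, hsub⟩ := exists_isCompact_symmDiff_geod_subset (n := n) (gdist x y / 2)
  have h := hμ.measure_symmDiff_eq (geod n (gdist x y / 2)) (geod n (-(gdist x y / 2)))
  rw [gdist_geod, sub_neg_eq_add, add_halves, abs_of_nonneg hd] at h
  rw [hμ.measure_symmDiff_eq, ← h]
  exact ((measure_mono hsub).trans_lt hK.measure_lt_top).ne

theorem IsInvariantMeasure.measureReal_symmDiff_eq (hμ : IsInvariantMeasure μ)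
    (x y : Space (n + 1)) :
    μ.real (symmDiff (halfSpacesThrough x) (halfSpacesThrough y)) =
      gdist x y * μ.real (symmDiff (halfSpacesThrough (geod n 0))
        (halfSpacesThrough (geod n 1))) := by
  have hshift : ∀ s t, 0 ≤ t →
      μ.real (symmDiff (halfSpacesThrough (geod n s)) (halfSpacesThrough (geod n (s + t)))) =
      μ.real (symmDiff (halfSpacesThrough (geod n 0)) (halfSpacesThrough (geod n t))) :=
    fun s t ht => by
      rw [measureReal_def, hμ.measure_symmDiff_eq, gdist_geod, sub_add_cancel_left, abs_neg,
        abs_of_nonneg ht, measureReal_def]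
  obtain ⟨-, hd, -⟩ := exists_smul_eq_geod x y
  rw [measureReal_def, hμ.measure_symmDiff_eq]
  refine eq_mul_of_additive_of_nonneg (F := fun t => μ.real
    (symmDiff (halfSpacesThrough (geod n 0)) (halfSpacesThrough (geod n t))))
    (fun s t hs ht => ?_) (fun t _ => measureReal_nonneg) hd
  obtain ⟨hunion, hdisj⟩ := symmDiff_geod_eq_union (n := n) hs (le_add_of_nonneg_right ht)
  have hm : ∀ x y : Space (n + 1),
      MeasurableSet (symmDiff (halfSpacesThrough x) (halfSpacesThrough y)) := fun x y =>
    (measurableSet_halfSpacesThrough x).symmDiff (measurableSet_halfSpacesThrough y)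
  rw [hunion, measureReal_union hdisj (hm _ _) (hμ.measure_symmDiff_ne_top _ _)
    (hμ.measure_symmDiff_ne_top _ _), hshift s t ht]

theorem IsInvariantMeasure.measureReal_symmDiff_geod_pos (hμ : IsInvariantMeasure μ) :
    0 < μ.real (symmDiff (halfSpacesThrough (geod n 0)) (halfSpacesThrough (geod n 1))) := by
  refine measureReal_nonneg.lt_of_ne fun h => hμ.ne_zero ?_
  -- otherwise `μ` vanishes on a neighbourhood of every half-space
  have hzero : ∀ x y : Space (n + 1),
      μ (symmDiff (halfSpacesThrough x) (halfSpacesThrough y)) = 0 := fun x y => by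
    rw [← measureReal_eq_zero_iff (hμ.measure_symmDiff_ne_top x y), hμ.measureReal_symmDiff_eq,
      ← h, mul_zero]
  rw [← Measure.measure_univ_eq_zero]
  refine measure_null_of_locally_null _ fun H _ => ?_
  obtain ⟨g, hg⟩ := exists_symmDiff_mem_nhds H
  exact ⟨_, mem_nhdsWithin_of_mem_nhds hg, hzero _ _⟩

/-- The Crofton formula: the distance of two points is proportional to the measure of the set of
half-spaces separating them. -/
theorem IsInvariantMeasure.exists_gdist_eq (hμ : IsInvariantMeasure μ) :
    ∃ k : ℝ, 0 < k ∧ ∀ x y : Space (n + 1),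
      gdist x y = k * (μ (symmDiff (halfSpacesThrough x) (halfSpacesThrough y))).toReal := by
  have hpos := hμ.measureReal_symmDiff_geod_pos
  refine ⟨_, inv_pos.mpr hpos, fun x y => ?_⟩
  rw [← measureReal_def, hμ.measureReal_symmDiff_eq x y, mul_comm (gdist x y),
    inv_mul_cancel_left₀ hpos.ne']

end Crofton

/-! ### The embedding into `L²` -/

section Hilbert

variable {n : ℕ} {μ : Measure (HalfSpace (n + 1))}

theorem vfun_sub_vfun_sq (x₀ x y : Space n) (H : HalfSpace n) :
    (vfun x₀ x H - vfun x₀ y H) ^ 2 =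
      (symmDiff (halfSpacesThrough x) (halfSpacesThrough y)).indicator (fun _ => (1 : ℝ)) H := by
  rw [vfun, vfun, sub_sub_sub_cancel_right]
  by_cases hx : H ∈ halfSpacesThrough x <;> by_cases hy : H ∈ halfSpacesThrough y <;>
    simp [Set.indicator, Set.mem_symmDiff, hx, hy]

theorem measurable_vfun (x₀ x : Space (n + 1)) : Measurable (vfun x₀ x) :=
  (measurable_const.indicator (measurableSet_halfSpacesThrough x)).sub
    (measurable_const.indicator (measurableSet_halfSpacesThrough x₀))

theorem vfun_self (x₀ : Space n) (H : HalfSpace n) : vfun x₀ x₀ H = 0 :=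
  sub_self _

theorem IsInvariantMeasure.memLp_vfun (hμ : IsInvariantMeasure μ) (x₀ x : Space (n + 1)) :
    MemLp (vfun x₀ x) 2 μ := by
  rw [memLp_two_iff_integrable_sq (measurable_vfun x₀ x).aestronglyMeasurable]
  have h : (fun H => vfun x₀ x H ^ 2) =
      (symmDiff (halfSpacesThrough x) (halfSpacesThrough x₀)).indicator fun _ => (1 : ℝ) := by
    funext H
    rw [← vfun_sub_vfun_sq x₀, vfun_self, sub_zero]
  rw [h, integrable_indicator_iff ((measurableSet_halfSpacesThrough _).symmDiff
    (measurableSet_halfSpacesThrough _)), integrableOn_const_iff]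
  exact Or.inr (hμ.measure_symmDiff_ne_top x x₀).lt_top

theorem IsInvariantMeasure.norm_sub_sq (hμ : IsInvariantMeasure μ) (x₀ x y : Space (n + 1)) :
    ‖(hμ.memLp_vfun x₀ x).toLp (vfun x₀ x) - (hμ.memLp_vfun x₀ y).toLp (vfun x₀ y)‖ ^ 2 =
      (μ (symmDiff (halfSpacesThrough x) (halfSpacesThrough y))).toReal := by
  rw [← MemLp.toLp_sub, ← real_inner_self_eq_norm_sq, L2.inner_def]
  have h : ∀ᵐ H ∂μ, inner ℝ
      (((hμ.memLp_vfun x₀ x).sub (hμ.memLp_vfun x₀ y)).toLp (vfun x₀ x - vfun x₀ y) H)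
      (((hμ.memLp_vfun x₀ x).sub (hμ.memLp_vfun x₀ y)).toLp (vfun x₀ x - vfun x₀ y) H) =
      (symmDiff (halfSpacesThrough x) (halfSpacesThrough y)).indicator (fun _ => (1 : ℝ)) H := by
    filter_upwards [((hμ.memLp_vfun x₀ x).sub (hμ.memLp_vfun x₀ y)).coeFn_toLp] with H hH
    rw [hH, real_inner_self_eq_norm_sq, Real.norm_eq_abs, sq_abs, Pi.sub_apply, vfun_sub_vfun_sq]
  rw [integral_congr_ae h, integral_indicator_const _ ((measurableSet_halfSpacesThrough _).symmDiff
    (measurableSet_halfSpacesThrough _)), smul_eq_mul, mul_one, measureReal_def]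

theorem IsInvariantMeasure.norm_smul_sub_sq (hμ : IsInvariantMeasure μ) {k : ℝ} (hk : 0 < k)
    (x₀ x y : Space (n + 1)) :
    ‖√k • (hμ.memLp_vfun x₀ x).toLp (vfun x₀ x) -
        √k • (hμ.memLp_vfun x₀ y).toLp (vfun x₀ y)‖ ^ 2 =
      k * (μ (symmDiff (halfSpacesThrough x) (halfSpacesThrough y))).toReal := by
  rw [← smul_sub, norm_smul, mul_pow, hμ.norm_sub_sq, Real.norm_eq_abs, sq_abs, Real.sq_sqrt hk.le]

/-- A kernel whose square root is a Hilbert space distance is of negative type: the sum in question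
equals `-2 ‖∑ tᵢ f(xᵢ)‖²`. -/
theorem isNegativeType_of_eq_norm_sub_sq {X E : Type*} [NormedAddCommGroup E]
    [InnerProductSpace ℝ E] {d : X → X → ℝ} (f : X → E) (h : ∀ x y, d x y = ‖f x - f y‖ ^ 2) :
    IsNegativeType d where
  diag x := by rw [h, sub_self, norm_zero, zero_pow two_ne_zero]
  symm x y := by rw [h, h, norm_sub_rev]
  sum_nonpos m x t ht := by
    have hsum : ∑ i, ∑ j, t i * t j * d (x i) (x j) = -2 * ‖∑ i, t i • f (x i)‖ ^ 2 := by
      have h1 : ∀ i j, t i * t j * d (x i) (x j) = t j * (t i * ‖f (x i)‖ ^ 2) +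
          t i * (t j * ‖f (x j)‖ ^ 2) - 2 * inner ℝ (t i • f (x i)) (t j • f (x j)) :=
        fun i j => by
          rw [h, norm_sub_sq_real, real_inner_smul_left, real_inner_smul_right]
          ring
      simp only [h1, Finset.sum_sub_distrib, Finset.sum_add_distrib, ← Finset.mul_sum,
        ← Finset.sum_mul, ht, zero_mul, ← inner_sum, ← sum_inner, real_inner_self_eq_norm_sq]
      simp
    rw [hsum]
    exact mul_nonpos_of_nonpos_of_nonneg (by norm_num) (sq_nonneg _)

end Hilbert

end RealHyperbolic

theorem corollary2p4 (n : ℕ) (hn : 1 ≤ n) :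
    (∃ μ : Measure (RealHyperbolic.HalfSpace n), RealHyperbolic.IsInvariantMeasure μ) ∧
    (∀ μ : Measure (RealHyperbolic.HalfSpace n), RealHyperbolic.IsInvariantMeasure μ →
      (∀ x : RealHyperbolic.Space n, MeasurableSet (RealHyperbolic.halfSpacesThrough x)) ∧
      ∃ k : ℝ, 0 < k ∧
        (∀ x y : RealHyperbolic.Space n,
          μ (symmDiff (RealHyperbolic.halfSpacesThrough x)
            (RealHyperbolic.halfSpacesThrough y)) ≠ ∞ ∧
          RealHyperbolic.gdist x y =
            k * (μ (symmDiff (RealHyperbolic.halfSpacesThrough x)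
              (RealHyperbolic.halfSpacesThrough y))).toReal) ∧
        (∀ x₀ : RealHyperbolic.Space n,
          ∃ hv : ∀ x : RealHyperbolic.Space n, MemLp (RealHyperbolic.vfun x₀ x) 2 μ,
            ∀ x y : RealHyperbolic.Space n,
              √(RealHyperbolic.gdist x y) =
                ‖√k • (hv x).toLp (RealHyperbolic.vfun x₀ x) -
                  √k • (hv y).toLp (RealHyperbolic.vfun x₀ y)‖)) ∧
    RealHyperbolic.IsMeasureDefinite
      (RealHyperbolic.gdist : RealHyperbolic.Space n → RealHyperbolic.Space n → ℝ) ∧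
    RealHyperbolic.IsNegativeType
      (RealHyperbolic.gdist : RealHyperbolic.Space n → RealHyperbolic.Space n → ℝ) := by
  obtain ⟨n, rfl⟩ := Nat.exists_eq_add_of_le' hn
  have hcone := RealHyperbolic.isInvariantMeasure_coneMeasure (n := n)
  obtain ⟨k, hk, hd⟩ := hcone.exists_gdist_eq
  refine ⟨⟨_, hcone⟩, fun μ hμ => ⟨RealHyperbolic.measurableSet_halfSpacesThrough, ?_⟩, ?_, ?_⟩
  · obtain ⟨k, hk, hd⟩ := hμ.exists_gdist_eq
    refine ⟨k, hk, fun x y => ⟨hμ.measure_symmDiff_ne_top x y, hd x y⟩, fun x₀ =>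
      ⟨hμ.memLp_vfun x₀, fun x y => ?_⟩⟩
    rw [hd, ← hμ.norm_smul_sub_sq hk x₀, Real.sqrt_sq (norm_nonneg _)]
  · refine ⟨RealHyperbolic.HalfSpace (n + 1), inferInstance,
      ENNReal.ofReal k • RealHyperbolic.coneMeasure n, RealHyperbolic.halfSpacesThrough,
      RealHyperbolic.measurableSet_halfSpacesThrough, fun x y => ⟨?_, ?_⟩⟩
    · exact ENNReal.mul_ne_top ENNReal.ofReal_ne_top (hcone.measure_symmDiff_ne_top x y)
    · rw [Measure.smul_apply, smul_eq_mul, ENNReal.toReal_mul, ENNReal.toReal_ofReal hk.le, hd]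
  · exact RealHyperbolic.isNegativeType_of_eq_norm_sub_sq _ fun x y => by
      rw [hd, ← hcone.norm_smul_sub_sq hk (RealHyperbolic.geod n 0)]
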